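/- Let $\mathsf p>\mathsf q>0$ and $q:=\mathsf q/\mathsf p\in(0,1)$. Let $\alpha,\gamma\ge 0$ satisfy Liggett's condition $\frac{\alpha}{\mathsf p}+\frac{\gamma}{\mathsf q}=1$, and let $\rho:=\alpha/\mathsf p$. The half-line open ASEP is the continuous-time Markov process $\eta(t)$ on $\{0,1\}^{\mathbb Z_{>0}}$ with generator $$\mathscr L f(\eta)=\alpha(1-\eta_1)\big(f(\eta^+)-f(\eta)\big)+\gamma\,\eta_1\big(f(\eta^-)-f(\eta)\big)+\sum_{x\ge 1}\big(\mathsf p\,\eta_x(1-\eta_{x+1})+\mathsf q\,\eta_{x+1}(1-\eta_x)\big)\big(f(\eta^{x,x+1})-f(\eta)\big)$$ on local functions $f$ (equivalently, the càdlàg process that solves the martingale problem for $\mathscr L$ on local functions). Here $\eta^{x,x+1}$ is $\eta$ with the values at $x$ and $x+1$ exchanged, and $\eta^+$ (resp. $\eta^-$) is $\eta$ with $\eta_1$ set to $1$ (resp. $0$). Put $N_x(\eta)=\sum_{i\ge x}\eta_i$, $Q_x(\eta)=q^{N_x(\eta)}$ (with $q^{\infty}=0$) and $H(\eta,\vec x)=\prod_{i=1}^n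 Q_{x_i}(\eta)$. For $y\in\mathbb Z_{\ge0}$ let $\mathbb W^n_{\ge y}=\{\vec x\in\mathbb Z^n: y\le x_1<\dots<x_n\}$. For $\vec x\in\mathbb Z^n$ let $\vec x_i^{\pm}$ be $\vec x$ with $x_i$ replaced by $x_i\pm1$. **Proposition.** Let $n\ge 1$ and let $\eta\in\{0,1\}^{\mathbb Z_{>0}}$ have finitely many particles. Suppose that $u:\mathbb R_+\times\mathbb Z_{\ge 0}^n\to\mathbb R$, where $\mathbb R_+=[0,\infty)$, satisfies: 1. for all $\vec x\in\mathbb Z_{\ge1}^n$ and $t\in\mathbb R_+$ (with a one-sided derivative at $t=0$), $$\frac{d}{dt}u(t;\vec x)=\Delta^{\mathsf p,\mathsf q}u(t;\vec x):=\sum_{i=1}^n\Big(\mathsf p\,u(t;\vec x_i^-)+\mathsf q\,u(t;\vec x_i^+)-(\mathsf p+\mathsf q)\,u(t;\vec x)\Big);$$ 2. for all $t\in\mathbb R_+$, all $i\in\{1,\dots,n-1\}$ and all $\vec x\in\mathbb Z_{\ge1}^n$ with $x_{i+1}=x_i+1$, $$\mathsf p\,u(t;\vec x_{i+1}^-)+\mathsf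 q\,u(t;\vec x_i^+)=(\mathsf p+\mathsf q)\,u(t;\vec x);$$ 3. for all $t\in\mathbb R_+$ and $(x_2,\dots,x_n)\in\mathbb W^{n-1}_{\ge2}$, $$u(t;0,x_2,\dots,x_n)=(\rho q+1-\rho)\,u(t;1,x_2,\dots,x_n);$$ 4. for every $T>0$ there are constants $c,C>0$ such that $|u(t;\vec x)|\le C\prod_{i=1}^n e^{c|x_i|}$ for all $t\in[0,T]$ and $\vec x\in\mathbb W^n_{\ge1}$; 5. $u(0;\vec x)=H(\eta,\vec x)$ for all $\vec x\in\mathbb W^n_{\ge1}$. Then for all $\vec x\in\mathbb W^n_{\ge1}$ and $t\in\mathbb R_+$ the random variable $H(\eta(t),\vec x)$ is integrable and $$u(t;\vec x)=\mathbb E^{\eta}\big[H(\eta(t),\vec x)\big],$$ where $\mathbb E^{\eta}$ is the expectation for the half-line open ASEP started from $\eta$. -/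

import Mathlib

open MeasureTheory ProbabilityTheory Filter Topology
open scoped NNReal

namespace HalfLineASEP

/-! ### Particle configurations -/

/-- Particle configurations on the sites `1, 2, 3, …`; `η x = true` means that site `x` is occupied.
The topology and the σ-algebra are the product ones. -/
abbrev Config : Type := ℕ+ → Bool

/-- The occupation variable `η_x ∈ {0, 1}`, as a real number. -/
def occ (η : Config) (x : ℕ+) : ℝ := if η x then 1 else 0

/-- `η^{x,x+1}`: the values at the sites `x` and `x + 1` are exchanged. -/
def exchange (η : Config) (x : ℕ+) : Config := η ∘ Equiv.swap x (x + 1)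

/-- A function of the configuration is local if it depends on finitely many sites only. -/
def IsLocal (f : Config → ℝ) : Prop := ∃ S : Finset ℕ+, DependsOn f (S : Set ℕ+)

/-! ### The half-line open ASEP -/

/-- The generator of the half-line open ASEP, acting on local functions: bulk jump rates `p` (to the
right) and `q` (to the left), injection rate `α` and ejection rate `γ` at site `1`.
For a local `f` all but finitely many terms of the series vanish. -/
noncomputable def generator (p q α γ : ℝ) (f : Config → ℝ) (η : Config) : ℝ :=
  α * (1 - occ η 1) * (f (Function.update η 1 true) - f η)
    + γ * occ η 1 * (f (Function.update η 1 false) - f η)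
    + ∑' x : ℕ+, (p * occ η x * (1 - occ η (x + 1)) + q * occ η (x + 1) * (1 - occ η x))
        * (f (exchange η x) - f η)

/-- `X` is a half-line open ASEP with rates `p, q, α, γ` started from the configuration `η`:
an adapted càdlàg process with `X 0 = η` almost surely that solves the martingale problem for the
generator on local functions. (The rates are bounded and of finite range, so this martingale problem
is well posed: it determines the law of the process, which is that of the Feller Markov process
with the given generator.) -/
structure IsASEP {Ω : Type*} [m : MeasurableSpace Ω] (p q α γ : ℝ) (P : Measure Ω)
    (ℱ : Filtration ℝ≥0 m) (X : ℝ≥0 → Ω → Config) (η : Config) : Prop where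
  adapted : ∀ t, Measurable[ℱ t] (X t)
  right_continuous : ∀ ω t, ContinuousWithinAt (fun s => X s ω) (Set.Ici t) t
  left_limits : ∀ ω t, ∃ ζ, Tendsto (fun s => X s ω) (𝓝[<] t) (𝓝 ζ)
  initial : ∀ᵐ ω ∂P, X 0 ω = η
  martingale : ∀ f : Config → ℝ, IsLocal f →
    Martingale (fun (t : ℝ≥0) ω =>
      f (X t ω) - ∫ s in (0 : ℝ)..t, generator p q α γ f (X s.toNNReal ω)) ℱ P

/-! ### The observables -/

open Classical in
/-- `Q_x(η) = r ^ N_x(η)`, where `N_x(η) = ∑_{i ≥ x} η_i` is the number of particles at sites `≥ x`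
and `r ∈ (0, 1)`, so that `r ^ ∞ = 0`. -/
noncomputable def Q (r : ℝ) (x : ℕ) (η : Config) : ℝ :=
  if {i : ℕ+ | x ≤ (i : ℕ) ∧ η i = true}.Finite then
    r ^ {i : ℕ+ | x ≤ (i : ℕ) ∧ η i = true}.ncard
  else 0

/-- `H(η, x) = ∏ᵢ Q_{xᵢ}(η)`. -/
noncomputable def H (r : ℝ) {n : ℕ} (η : Config) (x : Fin n → ℕ) : ℝ := ∏ i, Q r (x i) η

/-! ### The dual side -/

/-- The Weyl chamber `y ≤ x₁ < ⋯ < xₙ`. -/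
def weyl (n y : ℕ) : Set (Fin n → ℕ) := {x | StrictMono x ∧ ∀ i, y ≤ x i}

/-- `x` with its `i`-th coordinate decreased by one (used only where this coordinate is `≥ 1`). -/
def lower {n : ℕ} (x : Fin n → ℕ) (i : Fin n) : Fin n → ℕ := Function.update x i (x i - 1)

/-- `x` with its `i`-th coordinate increased by one. -/
def raise {n : ℕ} (x : Fin n → ℕ) (i : Fin n) : Fin n → ℕ := Function.update x i (x i + 1)

/-- The free operator `Δ^{p,q}`, at points with all coordinates `≥ 1`. -/
def freeOp (p q : ℝ) {n : ℕ} (f : (Fin n → ℕ) → ℝ) (x : Fin n → ℕ) : ℝ :=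
  ∑ i, (p * f (lower x i) + q * f (raise x i) - (p + q) * f x)

end HalfLineASEP

/-! ### Local truncations of the observables and the action of the generator on them. -/

namespace HalfLineASEP

/-! Both sides solve the same linear evolution equation on the Weyl chamber, and that equation has
only one solution of exponential growth with given initial data.

Duality, with `r = q / p`. A virtual site `0` of weight `θ = ρ r + 1 - ρ`, the mean weight of a site
occupied with probability `ρ`, extends the observable to points with a coordinate `0`. Liggett's
condition gives `α = p ρ` and `γ = q (1 - ρ)`, so the reservoir acts like an ASEP bond `(0, 1)`
averaged over the occupation of site `0`. `H` itself is not local; on its truncations the generator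
equals the free operator plus an error from the bond at the truncation edge (`generator_truncH`).
This error tends to `0` at every configuration: with finitely many particles the edge bond is
eventually inactive, with infinitely many the products themselves tend to `0`. Hence the number of
particles of the process need not be controlled, and Dynkin's formula with dominated convergence
gives the evolution equation for the expectation in integral form (`IsASEP.expect_extH`).

Uniqueness. The extended observable satisfies the two-body and reservoir relations, the former
because `1` and `r` are the roots of `p s ^ 2 + q = (p + q) s`. These relations, which `u` satisfies
too, eliminate every value outside the chamber from the free operator
(`BoundaryConditions.freeOp_eq`). The reduced operator is bounded in an exponentially weighted sup
norm, so iterating the equation for the difference of the two solutions bounds it by a multiple of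
`(K t) ^ k / k!` for every `k`; it is therefore zero (`eq_zero_of_weylOp`). -/

/-- The weight `r ^ η_j` of the site `j`; the fictitious site `0` has weight `θ`. -/
def siteWeight (r θ : ℝ) (η : Config) (j : ℕ) : ℝ :=
  if j = 0 then θ else if η j.toPNat' then r else 1

/-- The observable `Q_x` restricted to the sites `< L`, with the fictitious site `0` included. -/
def truncQ (r θ : ℝ) (L x : ℕ) (η : Config) : ℝ := ∏ j ∈ Finset.Ico x L, siteWeight r θ η j

/-- The local approximation of `H`. -/
def truncH (r θ : ℝ) (L : ℕ) {n : ℕ} (η : Config) (x : Fin n → ℕ) : ℝ :=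
  ∏ i, truncQ r θ L (x i) η

/-- The extension of `Q` to `x = 0` that encodes the boundary condition. -/
noncomputable def extQ (r θ : ℝ) (x : ℕ) (η : Config) : ℝ :=
  if x = 0 then θ * Q r 1 η else Q r x η

/-- The extension of `H` that encodes the boundary condition. -/
noncomputable def extH (r θ : ℝ) {n : ℕ} (η : Config) (x : Fin n → ℕ) : ℝ :=
  ∏ i, extQ r θ (x i) η

/-- The jump rate across the bond `(b, b + 1)`. -/
noncomputable def bondRate (p q : ℝ) (η : Config) (b : ℕ+) : ℝ :=
  p * occ η b * (1 - occ η (b + 1)) + q * occ η (b + 1) * (1 - occ η b)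

section Weights

variable (r θ : ℝ) (η : Config)

lemma siteWeight_pnat (b : ℕ+) : siteWeight r θ η b = if η b then r else 1 := by
  simp [siteWeight]

lemma siteWeight_succ (b : ℕ+) : siteWeight r θ η (b + 1) = if η (b + 1) then r else 1 := by
  rw [← siteWeight_pnat r θ η (b + 1)]; simp

lemma siteWeight_one : siteWeight r θ η 1 = if η 1 then r else 1 := by
  rw [← siteWeight_pnat r θ η 1]; simp

lemma siteWeight_zero : siteWeight r θ η 0 = θ := by simp [siteWeight]

lemma siteWeight_exchange_left (b : ℕ+) :
    siteWeight r θ (exchange η b) b = siteWeight r θ η (b + 1) := by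
  rw [siteWeight_pnat, siteWeight_succ]; simp [exchange]

lemma siteWeight_exchange_right (b : ℕ+) :
    siteWeight r θ (exchange η b) (b + 1) = siteWeight r θ η b := by
  rw [siteWeight_pnat, siteWeight_succ]; simp [exchange]

lemma siteWeight_exchange_of_ne (b : ℕ+) {j : ℕ} (h1 : j ≠ b) (h2 : j ≠ b + 1) :
    siteWeight r θ (exchange η b) j = siteWeight r θ η j := by
  rcases Nat.eq_zero_or_pos j with rfl | h
  · rfl
  lift j to ℕ+ using h
  rw [siteWeight_pnat, siteWeight_pnat, exchange, Function.comp_apply,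
    Equiv.swap_apply_of_ne_of_ne (fun e => h1 (by rw [e])) fun e => h2 (by rw [e]; simp)]

lemma siteWeight_exchange (b : ℕ+) (j : ℕ) :
    siteWeight r θ (exchange η b) j = siteWeight r θ η (Equiv.swap (b : ℕ) (b + 1) j) := by
  by_cases h1 : j = b
  · subst h1; rw [siteWeight_exchange_left, Equiv.swap_apply_left]
  by_cases h2 : j = b + 1
  · subst h2; rw [siteWeight_exchange_right, Equiv.swap_apply_right]
  rw [siteWeight_exchange_of_ne r θ η b h1 h2, Equiv.swap_apply_of_ne_of_ne h1 h2]

lemma siteWeight_update_of_ne (v : Bool) {j : ℕ} (hj : j ≠ 1) :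
    siteWeight r θ (Function.update η 1 v) j = siteWeight r θ η j := by
  rcases Nat.eq_zero_or_pos j with rfl | h
  · rfl
  lift j to ℕ+ using h
  rw [siteWeight_pnat, siteWeight_pnat, Function.update_of_ne fun e => hj (by rw [e]; rfl)]

lemma siteWeight_congr {η ζ : Config} {L : ℕ} (h : ∀ i : ℕ+, (i : ℕ) < L → η i = ζ i) {j : ℕ}
    (hj : j < L) : siteWeight r θ η j = siteWeight r θ ζ j := by
  rcases Nat.eq_zero_or_pos j with rfl | h0
  · rfl
  lift j to ℕ+ using h0
  rw [siteWeight_pnat, siteWeight_pnat, h j hj]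

variable {r θ}

lemma siteWeight_nonneg (hr : 0 ≤ r) (hθ : 0 ≤ θ) (j : ℕ) : 0 ≤ siteWeight r θ η j := by
  unfold siteWeight; split_ifs <;> simp_all

lemma siteWeight_le_one (hr : r ≤ 1) (hθ : θ ≤ 1) (j : ℕ) : siteWeight r θ η j ≤ 1 := by
  unfold siteWeight; split_ifs <;> simp_all

end Weights

lemma prod_comp_update {n : ℕ} (g : ℕ → ℝ) (x : Fin n → ℕ) (i : Fin n) (k : ℕ) :
    ∏ j, g (Function.update x i k j) = g k * ∏ j ∈ Finset.univ.erase i, g (x j) := by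
  rw [← Finset.mul_prod_erase _ _ (Finset.mem_univ i), Function.update_self]
  congr 1
  refine Finset.prod_congr rfl fun j hj => ?_
  rw [Function.update_of_ne (Finset.ne_of_mem_erase hj)]

section Truncated

variable (r θ : ℝ) {L : ℕ} (η : Config)

lemma truncQ_eq_mul {x : ℕ} (h : x < L) :
    truncQ r θ L x η = siteWeight r θ η x * truncQ r θ L (x + 1) η :=
  Finset.prod_eq_prod_Ico_succ_bot h _

lemma truncQ_succ_eq_mul {x : ℕ} (h : x ≤ L) :
    truncQ r θ (L + 1) x η = truncQ r θ L x η * siteWeight r θ η L :=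
  Finset.prod_Ico_succ_top h _

/-- The bond lies inside the window `[x, L)`, where the exchange permutes factors, or misses it
altogether. Only the bonds straddling an end of the window can change the product. -/
lemma truncQ_exchange_of_ne (b : ℕ+) {x : ℕ} (hx : (b : ℕ) + 1 ≠ x) (hL : (b : ℕ) + 1 ≠ L) :
    truncQ r θ L x (exchange η b) = truncQ r θ L x η := by
  unfold truncQ
  simp_rw [siteWeight_exchange]
  by_cases h : x ≤ b ∧ (b : ℕ) + 1 < L
  · refine Equiv.Perm.prod_comp (Equiv.swap (b : ℕ) (b + 1)) (Finset.Ico x L) _ ?_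
    intro a ha
    have : a = b ∨ a = b + 1 := by
      by_contra hc
      push Not at hc
      exact ha (Equiv.swap_apply_of_ne_of_ne hc.1 hc.2)
    simp only [Finset.coe_Ico, Set.mem_Ico]
    omega
  · refine Finset.prod_congr rfl fun j hj => ?_
    rw [Finset.mem_Ico] at hj
    rw [Equiv.swap_apply_of_ne_of_ne] <;> omega

lemma truncQ_exchange_bot (b : ℕ+) (h : (b : ℕ) + 1 < L) :
    truncQ r θ L (b + 1) (exchange η b) = siteWeight r θ η b * truncQ r θ L (b + 1 + 1) η := by
  rw [truncQ_eq_mul _ _ _ h, siteWeight_exchange_right,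
    truncQ_exchange_of_ne _ _ _ _ (by omega) (by omega)]

lemma truncQ_exchange_top (b : ℕ+) {x : ℕ} (h : x ≤ b) :
    truncQ r θ (b + 1) x (exchange η b) = truncQ r θ b x η * siteWeight r θ η (b + 1) := by
  rw [truncQ_succ_eq_mul _ _ _ h, siteWeight_exchange_left,
    truncQ_exchange_of_ne _ _ _ _ (by omega) (by omega)]

lemma truncQ_update_of_two_le (v : Bool) {x : ℕ} (h : 2 ≤ x) :
    truncQ r θ L x (Function.update η 1 v) = truncQ r θ L x η := by
  refine Finset.prod_congr rfl fun j hj => siteWeight_update_of_ne _ _ _ _ ?_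
  rw [Finset.mem_Ico] at hj
  omega

lemma truncH_update {n : ℕ} (x : Fin n → ℕ) (i : Fin n) (k : ℕ) :
    truncH r θ L η (Function.update x i k) =
      truncQ r θ L k η * ∏ j ∈ Finset.univ.erase i, truncQ r θ L (x j) η :=
  prod_comp_update (fun k => truncQ r θ L k η) x i k

lemma truncH_eq_mul {n : ℕ} (x : Fin n → ℕ) (i : Fin n) :
    truncH r θ L η x =
      truncQ r θ L (x i) η * ∏ j ∈ Finset.univ.erase i, truncQ r θ L (x j) η := by
  rw [← truncH_update, Function.update_eq_self]

lemma isLocal_truncH {n : ℕ} (L : ℕ) (x : Fin n → ℕ) :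
    IsLocal fun η => truncH r θ L η x := by
  refine ⟨Finset.Icc 1 L.succPNat, fun η ζ h => ?_⟩
  refine Finset.prod_congr rfl fun i _ => Finset.prod_congr rfl fun j hj => ?_
  refine siteWeight_congr r θ (L := L) (fun k hk => h k ?_) (Finset.mem_Ico.1 hj).2
  simp only [Finset.coe_Icc, Set.mem_Icc]
  refine ⟨one_le, ?_⟩
  rw [← PNat.coe_le_coe]
  simp only [Nat.succPNat_coe]
  omega

end Truncated

/-- The contribution of the coordinate `i` to the free operator. -/
def freeTerm (p q : ℝ) {n : ℕ} (f : (Fin n → ℕ) → ℝ) (x : Fin n → ℕ) (i : Fin n) : ℝ :=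
  p * f (lower x i) + q * f (raise x i) - (p + q) * f x

/-- Peeling off the sites `x i - 1` and `x i` leaves a common factor, so the duality reduces to an
identity in the weights of two neighbouring sites. -/
lemma freeTerm_truncH (p q r θ : ℝ) {L n : ℕ} (η : Config) (x : Fin n → ℕ) (i : Fin n)
    (h1 : 1 ≤ x i) (hL : x i < L) :
    freeTerm p q (truncH r θ L η) x i =
      (p * siteWeight r θ η (x i - 1) * siteWeight r θ η (x i) + q
        - (p + q) * siteWeight r θ η (x i)) * (truncQ r θ L (x i + 1) η *
          ∏ j ∈ Finset.univ.erase i, truncQ r θ L (x j) η) := by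
  unfold freeTerm lower raise
  rw [truncH_update, truncH_update, truncH_eq_mul r θ η x i,
    truncQ_eq_mul r θ η (show x i - 1 < L by omega), Nat.sub_add_cancel h1,
    truncQ_eq_mul r θ η hL]
  ring

/-- A jump across `(b, b + 1)` changes only the factor of a coordinate equal to `b + 1`, and
injectivity allows at most one. What remains is a check over the four occupations of the two sites,
using `p * r = q`. -/
lemma bondRate_mul_truncH_sub (p q r θ : ℝ) (hpr : p * r = q) {L n : ℕ} (η : Config)
    (x : Fin n → ℕ) (hx : Function.Injective x) (hL : ∀ i, x i < L) (b : ℕ+)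
    (hb : (b : ℕ) + 1 ≠ L) :
    bondRate p q η b * (truncH r θ L (exchange η b) x - truncH r θ L η x) =
      ∑ i, if (b : ℕ) + 1 = x i then freeTerm p q (truncH r θ L η) x i else 0 := by
  by_cases h : ∃ i, (b : ℕ) + 1 = x i
  · obtain ⟨i, hi⟩ := h
    rw [Finset.sum_eq_single i, if_pos hi]
    rotate_left
    · intro j _ hj
      rw [if_neg]
      intro e
      exact hj (hx (e.symm.trans hi))
    · simp
    have e : ∏ j ∈ Finset.univ.erase i, truncQ r θ L (x j) (exchange η b) =
        ∏ j ∈ Finset.univ.erase i, truncQ r θ L (x j) η := by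
      refine Finset.prod_congr rfl fun j hj => truncQ_exchange_of_ne _ _ _ _ ?_ hb
      intro e
      exact Finset.ne_of_mem_erase hj (hx (e.symm.trans hi))
    have hLi := hL i
    rw [freeTerm_truncH _ _ _ _ _ _ _ (by omega) hLi, truncH_eq_mul r θ η x i,
      truncH_eq_mul r θ _ x i, e, ← hi, truncQ_exchange_bot _ _ _ _ (by omega),
      truncQ_eq_mul r θ η (x := b + 1) (by omega), Nat.add_sub_cancel, siteWeight_pnat,
      siteWeight_succ]
    subst hpr
    unfold bondRate occ
    split_ifs <;> ring
  · push Not at h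
    rw [Finset.sum_eq_zero fun i _ => if_neg (h i)]
    have : truncH r θ L (exchange η b) x = truncH r θ L η x :=
      Finset.prod_congr rfl fun j _ => truncQ_exchange_of_ne _ _ _ _ (h j) hb
    rw [this, sub_self, mul_zero]

/-- The analogue of the bulk identity for the virtual bond `(0, 1)`: only a coordinate equal to `1`
feels the reservoir, and `θ` is the weight at site `0` that matches the rates `p ρ` and `q (1 - ρ)`.
-/
lemma reservoir_truncH (p q r θ α γ ρ : ℝ) (hpr : p * r = q) (hα : α = p * ρ)
    (hγ : γ = q * (1 - ρ)) (hθ : θ = ρ * r + 1 - ρ) {L n : ℕ} (η : Config)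
    (x : Fin n → ℕ) (hx : Function.Injective x) (hx1 : ∀ i, 1 ≤ x i) (hL : ∀ i, x i < L) :
    α * (1 - occ η 1) * (truncH r θ L (Function.update η 1 true) x - truncH r θ L η x)
      + γ * occ η 1 * (truncH r θ L (Function.update η 1 false) x - truncH r θ L η x) =
      ∑ i, if 1 = x i then freeTerm p q (truncH r θ L η) x i else 0 := by
  by_cases h : ∃ i, 1 = x i
  · obtain ⟨i, hi⟩ := h
    rw [Finset.sum_eq_single i, if_pos hi]
    rotate_left
    · intro j _ hj
      rw [if_neg]
      intro e
      exact hj (hx (e.symm.trans hi))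
    · simp
    have e (v : Bool) : ∏ j ∈ Finset.univ.erase i, truncQ r θ L (x j) (Function.update η 1 v) =
        ∏ j ∈ Finset.univ.erase i, truncQ r θ L (x j) η := by
      refine Finset.prod_congr rfl fun j hj => truncQ_update_of_two_le _ _ _ _ ?_
      have h1 : 1 ≠ x j := fun e => Finset.ne_of_mem_erase hj (hx (e.symm.trans hi))
      have h2 := hx1 j
      omega
    have hLi := hL i
    rw [freeTerm_truncH _ _ _ _ _ _ _ (hx1 i) hLi]
    simp only [truncH_eq_mul r θ _ x i, e, ← hi] at hLi ⊢
    simp only [truncQ_eq_mul r θ _ hLi, truncQ_update_of_two_le _ _ _ _ (le_refl 2),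
      siteWeight_one, Function.update_self, siteWeight_zero, Nat.sub_self, Nat.reduceAdd]
    subst hpr hα hγ hθ
    unfold occ
    split_ifs <;> first | contradiction | ring
  · push Not at h
    rw [Finset.sum_eq_zero fun i _ => if_neg (h i)]
    have (v : Bool) : truncH r θ L (Function.update η 1 v) x = truncH r θ L η x :=
      Finset.prod_congr rfl fun j _ => truncQ_update_of_two_le _ _ _ _ (by
        have h1 := h j
        have h2 := hx1 j
        omega)
    rw [this, this, sub_self, mul_zero, mul_zero, add_zero]

/-- Bulk bonds start at `(1, 2)`, hence the threshold `2 ≤ k`; a coordinate equal to `1` is served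
by the reservoir. -/
lemma hasSum_ite_succ_eq (k : ℕ) (a : ℝ) :
    HasSum (fun b : ℕ+ => if (b : ℕ) + 1 = k then a else 0) (if 2 ≤ k then a else 0) := by
  split_ifs with h
  · have := hasSum_single (f := fun b : ℕ+ => if (b : ℕ) + 1 = k then a else 0)
      (⟨k - 1, by omega⟩ : ℕ+) (fun b hb => if_neg fun e => hb (PNat.eq (by
        simp only [PNat.mk_coe]; omega)))
    simpa [show k - 1 + 1 = k by omega] using this
  · have : (fun b : ℕ+ => if (b : ℕ) + 1 = k then a else 0) = fun _ => 0 := by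
      ext b
      rw [if_neg]
      have := b.pos
      omega
    rw [this]
    exact hasSum_zero

/-- The action of the generator on the truncated observables: the free operator, plus an error
from the last bond. -/
lemma generator_truncH (p q r θ α γ ρ : ℝ) (hpr : p * r = q) (hα : α = p * ρ)
    (hγ : γ = q * (1 - ρ)) (hθ : θ = ρ * r + 1 - ρ) {n : ℕ} (b : ℕ+) (η : Config)
    (x : Fin n → ℕ) (hx : x ∈ weyl n 1) (hL : ∀ i, x i ≤ b) :
    generator p q α γ (fun η => truncH r θ (b + 1) η x) η =
      freeOp p q (truncH r θ (b + 1) η) x +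
        bondRate p q η b * (truncH r θ (b + 1) (exchange η b) x - truncH r θ (b + 1) η x) := by
  have hinj := hx.1.injective
  have hL' : ∀ i, x i < b + 1 := fun i => Nat.lt_succ_of_le (hL i)
  set D := freeTerm p q (truncH r θ (b + 1) η) x with hD
  set E := bondRate p q η b *
    (truncH r θ (b + 1) (exchange η b) x - truncH r θ (b + 1) η x) with hE
  have key : HasSum (fun c : ℕ+ => bondRate p q η c *
      (truncH r θ (b + 1) (exchange η c) x - truncH r θ (b + 1) η x))
      ((∑ i, if 2 ≤ x i then D i else 0) + E) := by
    -- Every bond `c ≠ b` gives the free terms of the coordinates at `c + 1`. The edge bond `c = b`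
    -- gives only `E`, since no coordinate equals `b + 1`.
    have h1 := (hasSum_sum (s := Finset.univ) fun i _ => hasSum_ite_succ_eq (x i) (D i)).add
      (hasSum_ite_succ_eq (b + 1) E)
    rw [if_pos (show 2 ≤ (b : ℕ) + 1 by have := b.pos; omega)] at h1
    convert h1 using 2 with c
    by_cases hc : c = b
    · subst hc
      rw [if_pos rfl, Finset.sum_eq_zero, zero_add]
      intro i _
      rw [if_neg]
      have := hL i
      omega
    · have hc' : (c : ℕ) + 1 ≠ b + 1 := fun e => hc (PNat.eq (by omega))
      rw [if_neg hc', add_zero]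
      exact bondRate_mul_truncH_sub p q r θ hpr η x hinj hL' c hc'
  unfold generator
  have key' := key.tsum_eq
  unfold bondRate at key'
  rw [key', reservoir_truncH p q r θ α γ ρ hpr hα hγ hθ η x hinj hx.2 hL', ← add_assoc,
    ← Finset.sum_add_distrib]
  congr 1
  refine Finset.sum_congr rfl fun i _ => ?_
  have := hx.2 i
  by_cases h1 : 1 = x i
  · rw [if_pos h1, if_neg (by omega), add_zero]; rfl
  · rw [if_neg h1, if_pos (by omega), zero_add]; rfl

end HalfLineASEP

/-! ### Uniform bounds, removal of the truncation, and measurability. -/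

namespace HalfLineASEP

section Bounds

variable {r θ : ℝ} (hr0 : 0 ≤ r) (hr1 : r ≤ 1) (hθ0 : 0 ≤ θ) (hθ1 : θ ≤ 1) (η : Config)
include hr0 hθ0

lemma truncQ_nonneg (L x : ℕ) : 0 ≤ truncQ r θ L x η :=
  Finset.prod_nonneg fun j _ => siteWeight_nonneg η hr0 hθ0 j

lemma truncH_nonneg {n : ℕ} (L : ℕ) (x : Fin n → ℕ) : 0 ≤ truncH r θ L η x :=
  Finset.prod_nonneg fun i _ => truncQ_nonneg hr0 hθ0 η L (x i)

include hr1 hθ1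

lemma truncQ_le_one (L x : ℕ) : truncQ r θ L x η ≤ 1 :=
  Finset.prod_le_one (fun j _ => siteWeight_nonneg η hr0 hθ0 j)
    fun j _ => siteWeight_le_one η hr1 hθ1 j

lemma truncH_le_one {n : ℕ} (L : ℕ) (x : Fin n → ℕ) : truncH r θ L η x ≤ 1 :=
  Finset.prod_le_one (fun i _ => truncQ_nonneg hr0 hθ0 η L (x i))
    fun i _ => truncQ_le_one hr0 hr1 hθ0 hθ1 η L (x i)

lemma abs_truncH_le_one {n : ℕ} (L : ℕ) (x : Fin n → ℕ) : |truncH r θ L η x| ≤ 1 :=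
  abs_le.2 ⟨by linarith [truncH_nonneg hr0 hθ0 η L x], truncH_le_one hr0 hr1 hθ0 hθ1 η L x⟩

/-- The exchange brings the value of site `b + 1` to the last site of the window; dropping its
weight, at most `1`, leaves a product of the unexchanged configuration. Thus the edge error is
controlled by truncations of one fixed configuration. -/
lemma truncH_exchange_le {n : ℕ} (b : ℕ+) (x : Fin n → ℕ) (hx : ∀ i, x i ≤ b) :
    truncH r θ (b + 1) (exchange η b) x ≤ truncH r θ b η x := by
  refine Finset.prod_le_prod (fun i _ => truncQ_nonneg hr0 hθ0 _ _ _) fun i _ => ?_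
  rw [truncQ_exchange_top _ _ _ _ (hx i)]
  exact mul_le_of_le_one_right (truncQ_nonneg hr0 hθ0 _ _ _) (siteWeight_le_one η hr1 hθ1 _)

end Bounds

lemma abs_occ_mul_le (η : Config) (x y : ℕ+) : |occ η x * (1 - occ η y)| ≤ 1 := by
  unfold occ; split_ifs <;> norm_num

lemma abs_bondRate_le {p q : ℝ} (hp : 0 ≤ p) (hq : 0 ≤ q) (η : Config) (b : ℕ+) :
    |bondRate p q η b| ≤ p + q := by
  unfold bondRate
  rw [mul_assoc, mul_assoc]
  refine (abs_add_le _ _).trans (add_le_add ?_ ?_) <;>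
  · rw [abs_mul, abs_of_nonneg (by assumption)]
    exact mul_le_of_le_one_right (by assumption) (abs_occ_mul_le _ _ _)

section Limits

variable (r θ : ℝ) (η : Config)

/-- The occupied sites in `[x, L)`. -/
def occupied (x L : ℕ) (η : Config) : Finset ℕ+ :=
  ((Finset.Ico x L).filter fun j => 0 < j ∧ η j.toPNat').image Nat.toPNat'

lemma mem_occupied {x L : ℕ} {η : Config} {i : ℕ+} :
    i ∈ occupied x L η ↔ (x ≤ i ∧ (i : ℕ) < L) ∧ η i = true := by
  simp only [occupied, Finset.mem_image, Finset.mem_filter, Finset.mem_Ico]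
  constructor
  · rintro ⟨j, ⟨h, h0, h'⟩, rfl⟩
    rw [Nat.toPNat'_coe, if_pos h0]
    exact ⟨h, h'⟩
  · rintro ⟨h, h'⟩
    exact ⟨i, ⟨h, i.pos, by simpa using h'⟩, by simp⟩

lemma truncQ_eq_pow {x L : ℕ} (hx : 1 ≤ x) :
    truncQ r θ L x η = r ^ (occupied x L η).card := by
  rw [occupied, Finset.card_image_of_injOn, truncQ, ← Finset.prod_const, Finset.prod_filter]
  · refine Finset.prod_congr rfl fun j hj => ?_
    have h0 : 0 < j := hx.trans (Finset.mem_Ico.1 hj).1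
    simp [siteWeight, h0, h0.ne']
  · intro a ha b hb h
    simp only [Finset.coe_filter, Set.mem_ofPred_eq] at ha hb
    have := congrArg PNat.val h
    simpa [Nat.toPNat'_coe, ha.2.1, hb.2.1] using this

lemma eventually_subset_occupied {x : ℕ} (A : Finset ℕ+) (hA : ∀ i ∈ A, x ≤ i ∧ η i = true) :
    ∀ᶠ L in atTop, A ⊆ occupied x L η := by
  have : ∀ᶠ L in atTop, ∀ i ∈ A, (i : ℕ) < L :=
    (Finset.eventually_all A).2 fun i _ => eventually_gt_atTop _
  filter_upwards [this] with L hL i hi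
  exact mem_occupied.2 ⟨⟨(hA i hi).1, hL i hi⟩, (hA i hi).2⟩

lemma extH_eq_zero_of_infinite {n : ℕ} (x : Fin (n + 1) → ℕ) (hx : ∀ i, 1 ≤ x i)
    (h : ¬ {i : ℕ+ | η i = true}.Finite) : extH r θ η x = 0 := by
  refine Finset.prod_eq_zero (Finset.mem_univ 0) ?_
  rw [extQ, if_neg (by have := hx 0; omega), Q, if_neg]
  intro hf
  refine h ((hf.union (Set.finite_Iio (x 0).succPNat)).subset fun i hi => ?_)
  by_cases hxi : x 0 ≤ i
  · exact Or.inl ⟨hxi, hi⟩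
  · refine Or.inr ?_
    rw [Set.mem_Iio, ← PNat.coe_lt_coe, Nat.succPNat_coe]
    omega

variable {r} (hr0 : 0 ≤ r) (hr1 : r < 1)
include hr0 hr1

/-- The exponent is eventually constant or tends to infinity; the convention `r ^ ∞ = 0` makes the
limit correct in the second case. -/
lemma tendsto_truncQ_of_one_le {x : ℕ} (hx : 1 ≤ x) :
    Tendsto (fun L => truncQ r θ L x η) atTop (𝓝 (Q r x η)) := by
  simp_rw [truncQ_eq_pow r θ η hx]
  unfold Q
  split_ifs with h
  · refine tendsto_const_nhds.congr' ?_
    filter_upwards [eventually_subset_occupied η h.toFinset (x := x) fun i hi => by simpa using hi]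
      with L hL
    have e : occupied x L η = h.toFinset := by
      refine Finset.Subset.antisymm (fun i hi => ?_) hL
      have := mem_occupied.1 hi
      simp [this.1.1, this.2]
    rw [e, Set.ncard_eq_toFinset_card _ h]
  · refine (tendsto_pow_atTop_nhds_zero_of_lt_one hr0 hr1).comp (tendsto_atTop.2 fun m => ?_)
    obtain ⟨A, hA, hm⟩ := Set.Infinite.exists_subset_card_eq h m
    filter_upwards [eventually_subset_occupied η A (x := x) fun i hi => hA hi] with L hL
    exact hm ▸ Finset.card_le_card hL

lemma tendsto_truncQ (x : ℕ) :
    Tendsto (fun L => truncQ r θ L x η) atTop (𝓝 (extQ r θ x η)) := by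
  unfold extQ
  split_ifs with h
  · subst h
    refine ((tendsto_truncQ_of_one_le θ η hr0 hr1 le_rfl).const_mul θ).congr' ?_
    filter_upwards [eventually_gt_atTop 0] with L hL
    rw [truncQ_eq_mul _ _ _ hL, siteWeight_zero]
  · exact tendsto_truncQ_of_one_le θ η hr0 hr1 (Nat.one_le_iff_ne_zero.2 h)

lemma tendsto_truncH {n : ℕ} (x : Fin n → ℕ) :
    Tendsto (fun L => truncH r θ L η x) atTop (𝓝 (extH r θ η x)) :=
  tendsto_finsetProd _ fun i _ => tendsto_truncQ θ η hr0 hr1 (x i)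

lemma extH_mem_Icc {n : ℕ} (x : Fin n → ℕ) (hθ0 : 0 ≤ θ) (hθ1 : θ ≤ 1) :
    extH r θ η x ∈ Set.Icc 0 1 :=
  isClosed_Icc.mem_of_tendsto (tendsto_truncH θ η hr0 hr1 x) (Eventually.of_forall fun L =>
    ⟨truncH_nonneg hr0 hθ0 η L x, truncH_le_one hr0 hr1.le hθ0 hθ1 η L x⟩)

/-- The error from the last bond vanishes in the limit, for every configuration. -/
lemma tendsto_bondRate_mul_truncH_sub (p q : ℝ) (hp : 0 ≤ p) (hq : 0 ≤ q) (hθ0 : 0 ≤ θ)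
    (hθ1 : θ ≤ 1) {n : ℕ} (x : Fin (n + 1) → ℕ) (hx : ∀ i, 1 ≤ x i) :
    Tendsto (fun k : ℕ => bondRate p q η k.succPNat *
      (truncH r θ (k.succPNat + 1) (exchange η k.succPNat) x - truncH r θ (k.succPNat + 1) η x))
      atTop (𝓝 0) := by
  -- With finitely many particles both sites of a distant bond are empty and its rate is `0`. With
  -- infinitely many, the rate is bounded and both truncated products tend to `0`.
  by_cases h : {i : ℕ+ | η i = true}.Finite
  · refine tendsto_const_nhds.congr' ?_
    have : ∀ᶠ k : ℕ in atTop, ∀ i ∈ h.toFinset, (i : ℕ) < k.succPNat :=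
      (Finset.eventually_all _).2 fun i _ => by
        filter_upwards [eventually_ge_atTop (i : ℕ)] with k hk
        simp only [Nat.succPNat_coe]
        omega
    filter_upwards [this] with k hk
    have h1 : η k.succPNat = false := by
      by_contra hc
      have := hk k.succPNat (by simpa using hc)
      omega
    have h2 : η (k.succPNat + 1) = false := by
      by_contra hc
      have := hk (k.succPNat + 1) (by simpa using hc)
      simp at this
    simp [bondRate, occ, h1, h2]
  · have h0 : Tendsto (fun L => truncH r θ L η x) atTop (𝓝 0) := by
      have := tendsto_truncH θ η hr0 hr1 x
      rwa [extH_eq_zero_of_infinite r θ η x hx h] at this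
    have h1 : Tendsto (fun k : ℕ => truncH r θ (k + 1) η x) atTop (𝓝 0) :=
      h0.comp (tendsto_add_atTop_nat 1)
    have h2 : Tendsto (fun k : ℕ => truncH r θ (k + 1 + 1) η x) atTop (𝓝 0) :=
      h0.comp (tendsto_add_atTop_nat 2)
    have h3 := (h1.add h2).const_mul (p + q)
    rw [add_zero, mul_zero] at h3
    refine squeeze_zero_norm' ?_ h3
    have : ∀ᶠ k : ℕ in atTop, ∀ i, x i ≤ k :=
      eventually_all.2 fun i => eventually_ge_atTop _
    filter_upwards [this] with k hk
    rw [norm_mul, Real.norm_eq_abs, Real.norm_eq_abs]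
    refine mul_le_mul (abs_bondRate_le hp hq _ _) ?_ (abs_nonneg _) (by positivity)
    have a1 := truncH_exchange_le hr0 hr1.le hθ0 hθ1 η k.succPNat x fun i => by
      simp only [Nat.succPNat_coe]
      exact (hk i).trans k.le_succ
    have a2 := truncH_nonneg hr0 hθ0 (exchange η k.succPNat) (k.succPNat + 1) x
    have a3 := truncH_nonneg hr0 hθ0 η (k + 1 + 1) x
    have a4 := truncH_nonneg hr0 hθ0 η (k + 1) x
    simp only [Nat.succPNat_coe, Nat.succ_eq_add_one] at a1 a2 ⊢
    rw [abs_le]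
    constructor <;> linarith

end Limits

section Measurability

variable (r θ : ℝ)

lemma measurable_siteWeight (j : ℕ) : Measurable fun η => siteWeight r θ η j := by
  unfold siteWeight
  split_ifs
  · exact measurable_const
  · exact Measurable.ite (measurable_pi_apply (X := fun _ : ℕ+ => Bool) j.toPNat'
      (measurableSet_singleton true)) measurable_const measurable_const

lemma measurable_truncH (L : ℕ) {n : ℕ} (x : Fin n → ℕ) :
    Measurable fun η => truncH r θ L η x :=
  Finset.measurable_fun_prod _ fun _ _ =>
    Finset.measurable_fun_prod _ fun j _ => measurable_siteWeight r θ j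

lemma measurable_exchange (b : ℕ+) : Measurable fun η => exchange η b :=
  measurable_pi_lambda _ fun _ => measurable_pi_apply _

lemma measurable_occ (b : ℕ+) : Measurable fun η => occ η b :=
  Measurable.ite (measurable_pi_apply (X := fun _ : ℕ+ => Bool) b
    (measurableSet_singleton true)) measurable_const measurable_const

lemma measurable_bondRate (p q : ℝ) (b : ℕ+) : Measurable fun η => bondRate p q η b := by
  have h1 := measurable_occ b
  have h2 := measurable_occ (b + 1)
  unfold bondRate
  fun_prop

variable {r}

lemma measurable_extH (hr0 : 0 ≤ r) (hr1 : r < 1) {n : ℕ} (x : Fin n → ℕ) :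
    Measurable fun η => extH r θ η x :=
  measurable_of_tendsto_metrizable (fun L => measurable_truncH r θ L x)
    (tendsto_pi_nhds.2 fun η => tendsto_truncH θ η hr0 hr1 x)

end Measurability

section FreeOp

variable (p q : ℝ) {n : ℕ} (x : Fin n → ℕ)

lemma tendsto_freeOp {ι : Type*} {l : Filter ι} {f : ι → (Fin n → ℕ) → ℝ}
    {g : (Fin n → ℕ) → ℝ} (h : ∀ y, Tendsto (fun k => f k y) l (𝓝 (g y))) :
    Tendsto (fun k => freeOp p q (f k) x) l (𝓝 (freeOp p q g x)) :=
  tendsto_finsetSum _ fun _ _ => (((h _).const_mul p).add ((h _).const_mul q)).sub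
    ((h _).const_mul (p + q))

lemma measurable_freeOp {E : Type*} [MeasurableSpace E] {f : E → (Fin n → ℕ) → ℝ}
    (h : ∀ y, Measurable fun e => f e y) : Measurable fun e => freeOp p q (f e) x :=
  Finset.measurable_fun_sum _ fun _ _ => (((h _).const_mul p).add ((h _).const_mul q)).sub
    ((h _).const_mul (p + q))

lemma integral_freeOp {Ω : Type*} [MeasurableSpace Ω] {P : Measure Ω}
    {f : Ω → (Fin n → ℕ) → ℝ} (h : ∀ y, Integrable (fun ω => f ω y) P) :
    ∫ ω, freeOp p q (f ω) x ∂P = freeOp p q (fun y => ∫ ω, f ω y ∂P) x := by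
  have h1 (y : Fin n → ℕ) := (h y).const_mul p
  have h2 (y : Fin n → ℕ) := (h y).const_mul q
  have h3 := (h x).const_mul (p + q)
  have h4 (y z : Fin n → ℕ) : Integrable (fun ω => p * f ω y + q * f ω z) P := (h1 y).add (h2 z)
  have h5 (y z : Fin n → ℕ) :
      Integrable (fun ω => p * f ω y + q * f ω z - (p + q) * f ω x) P := (h4 y z).sub h3
  unfold freeOp
  rw [integral_finsetSum _ fun i _ => h5 _ _]
  refine Finset.sum_congr rfl fun i _ => ?_
  rw [integral_sub (h4 _ _) h3, integral_add (h1 _) (h2 _)]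
  simp only [integral_const_mul]

variable {p q}

lemma abs_freeOp_le (hp : 0 ≤ p) (hq : 0 ≤ q) {f : (Fin n → ℕ) → ℝ} (h : ∀ y, |f y| ≤ 1) :
    |freeOp p q f x| ≤ n * (2 * (p + q)) := by
  refine (Finset.abs_sum_le_sum_abs _ _).trans ?_
  refine (Finset.sum_le_card_nsmul _ _ (2 * (p + q)) fun i _ => ?_).trans (by simp)
  have h1 := abs_le.1 (h (lower x i))
  have h2 := abs_le.1 (h (raise x i))
  have h3 := abs_le.1 (h x)
  rw [abs_le]
  constructor <;> nlinarith

end FreeOp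

end HalfLineASEP

/-! ### Joint measurability, expectations along the process, and Dynkin's formula. -/

namespace HalfLineASEP

/-- The approximation of a time from the right by the grid of mesh `1 / (n + 1)`. -/
noncomputable def rightGrid (n : ℕ) (s : ℝ≥0) : ℝ≥0 := (⌊(n + 1) * s⌋₊ + 1) / (n + 1)

lemma le_rightGrid (n : ℕ) (s : ℝ≥0) : s ≤ rightGrid n s := by
  rw [rightGrid, le_div_iff₀ (by positivity), mul_comm]
  exact (Nat.lt_floor_add_one _).le

lemma rightGrid_le (n : ℕ) (s : ℝ≥0) : rightGrid n s ≤ s + 1 / (n + 1) := by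
  rw [rightGrid, add_div]
  gcongr
  rw [div_le_iff₀ (by positivity), mul_comm]
  exact Nat.floor_le (zero_le)

lemma tendsto_rightGrid (s : ℝ≥0) : Tendsto (fun n => rightGrid n s) atTop (𝓝[≥] s) := by
  refine tendsto_nhdsWithin_iff.2 ⟨?_, Eventually.of_forall fun n => le_rightGrid n s⟩
  refine tendsto_of_tendsto_of_tendsto_of_le_of_le tendsto_const_nhds ?_
    (fun n => le_rightGrid n s) (fun n => rightGrid_le n s)
  have := (tendsto_one_div_add_atTop_nhds_zero_nat (𝕜 := ℝ≥0)).const_add s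
  rwa [add_zero] at this

/-- A right-continuous process is jointly measurable. -/
lemma measurable_uncurry_of_rightContinuous {Ω E : Type*} [MeasurableSpace Ω]
    [TopologicalSpace E] [TopologicalSpace.PseudoMetrizableSpace E] [MeasurableSpace E]
    [BorelSpace E] (X : ℝ≥0 → Ω → E) (hX : ∀ t, Measurable (X t))
    (hc : ∀ ω t, ContinuousWithinAt (fun s => X s ω) (Set.Ici t) t) :
    Measurable fun z : ℝ≥0 × Ω => X z.1 z.2 := by
  have hlim : Tendsto (fun (n : ℕ) (z : ℝ≥0 × Ω) => X (rightGrid n z.1) z.2) atTop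
      (𝓝 fun z : ℝ≥0 × Ω => X z.1 z.2) := by
    refine tendsto_pi_nhds.2 fun z => ?_
    have h1 := hc z.2 z.1
    rw [ContinuousWithinAt] at h1
    exact h1.comp (tendsto_rightGrid z.1)
  refine measurable_of_tendsto_metrizable (fun n => ?_) hlim
  -- The grid time takes countably many values, so joint measurability of the discretised process
  -- reduces to measurability in `ω` at each grid time.
  generalize hg : (fun k : ℕ => (k + 1) / (n + 1) : ℕ → ℝ≥0) = g
  have hg' (s : ℝ≥0) : rightGrid n s = g ⌊(n + 1) * s⌋₊ := by rw [← hg, rightGrid]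
  simp only [hg']
  have h1 : Measurable fun w : ℕ × Ω => X (g w.1) w.2 :=
    measurable_from_prod_countable_right fun k => hX (g k)
  have h2 : Measurable fun z : ℝ≥0 × Ω => (⌊(n + 1) * z.1⌋₊, z.2) :=
    (Nat.measurable_floor.comp (measurable_fst.const_mul _)).prodMk measurable_snd
  exact h1.comp h2

section Expectation

variable {Ω : Type*} [m : MeasurableSpace Ω] (P : Measure Ω) (X : ℝ≥0 → Ω → Config)

/-- The expectation of `F` at time `t`. -/
noncomputable def expect (F : Config → ℝ) (t : ℝ) : ℝ := ∫ ω, F (X t.toNNReal ω) ∂P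

variable {P X} [IsProbabilityMeasure P]

lemma abs_expect_le {F : Config → ℝ} {C : ℝ} (hC : ∀ η, |F η| ≤ C) (t : ℝ) :
    |expect P X F t| ≤ C := by
  have := norm_integral_le_of_norm_le_const (μ := P) (f := fun ω => F (X t.toNNReal ω))
    (Eventually.of_forall fun ω => hC _)
  simpa [expect] using this

variable {F : Config → ℝ} {C : ℝ}

lemma integrable_comp (hX : ∀ t, Measurable (X t)) (hF : Measurable F) (hC : ∀ η, |F η| ≤ C)
    (t : ℝ≥0) : Integrable (fun ω => F (X t ω)) P :=
  Integrable.of_bound (hF.comp (hX t)).aestronglyMeasurable C (Eventually.of_forall fun _ => hC _)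

lemma measurable_process (hX : Measurable fun z : ℝ≥0 × Ω => X z.1 z.2) (t : ℝ≥0) :
    Measurable (X t) := hX.comp (measurable_const.prodMk measurable_id)

lemma measurable_process_real (hX : Measurable fun z : ℝ≥0 × Ω => X z.1 z.2)
    (hF : Measurable F) : Measurable fun z : ℝ × Ω => F (X z.1.toNNReal z.2) :=
  hF.comp (hX.comp ((measurable_real_toNNReal.comp measurable_fst).prodMk measurable_snd))

lemma measurable_expect (hX : Measurable fun z : ℝ≥0 × Ω => X z.1 z.2)
    (hF : Measurable F) : Measurable (expect P X F) :=
  (measurable_process_real hX hF).stronglyMeasurable.integral_prod_right'.measurable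

lemma tendsto_expect (hX : ∀ t, Measurable (X t)) {G : ℕ → Config → ℝ}
    (hG : ∀ k, Measurable (G k)) (hGC : ∀ᶠ k in atTop, ∀ η, |G k η| ≤ C)
    (hlim : ∀ η, Tendsto (fun k => G k η) atTop (𝓝 (F η))) (t : ℝ) :
    Tendsto (fun k => expect P X (G k) t) atTop (𝓝 (expect P X F t)) :=
  tendsto_integral_filter_of_dominated_convergence (fun _ => C)
    (Eventually.of_forall fun k => ((hG k).comp (hX _)).aestronglyMeasurable)
    (hGC.mono fun _ hk => Eventually.of_forall fun _ => hk _) (integrable_const C)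
    (Eventually.of_forall fun _ => hlim _)

lemma tendsto_integral_expect (hX : Measurable fun z : ℝ≥0 × Ω => X z.1 z.2)
    {G : ℕ → Config → ℝ}
    (hG : ∀ k, Measurable (G k)) (hGC : ∀ᶠ k in atTop, ∀ η, |G k η| ≤ C)
    (hlim : ∀ η, Tendsto (fun k => G k η) atTop (𝓝 (F η))) (t : ℝ) :
    Tendsto (fun k => ∫ s in (0 : ℝ)..t, expect P X (G k) s) atTop
      (𝓝 (∫ s in (0 : ℝ)..t, expect P X F s)) :=
  intervalIntegral.tendsto_integral_filter_of_dominated_convergence (fun _ => C)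
    (Eventually.of_forall fun k => (measurable_expect hX (hG k)).aestronglyMeasurable)
    (hGC.mono fun _ hk => Eventually.of_forall fun s _ => abs_expect_le hk s)
    intervalIntegrable_const
    (Eventually.of_forall fun s _ => tendsto_expect (measurable_process hX) hG hGC hlim s)

lemma integral_intervalIntegral_process (hX : Measurable fun z : ℝ≥0 × Ω => X z.1 z.2)
    (hF : Measurable F) (hC : ∀ η, |F η| ≤ C) (t : ℝ) :
    Integrable (fun ω => ∫ s in (0 : ℝ)..t, F (X s.toNNReal ω)) P ∧
      ∫ ω, (∫ s in (0 : ℝ)..t, F (X s.toNNReal ω)) ∂P = ∫ s in (0 : ℝ)..t, expect P X F s := by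
  have : IsFiniteMeasure (volume.restrict (Set.uIoc 0 t)) :=
    ⟨by simp [Set.uIoc]⟩
  have hi : Integrable (fun z : ℝ × Ω => F (X z.1.toNNReal z.2))
      ((volume.restrict (Set.uIoc 0 t)).prod P) :=
    Integrable.of_bound (measurable_process_real hX hF).aestronglyMeasurable C
      (Eventually.of_forall fun _ => hC _)
  refine ⟨?_, ?_⟩
  · simp only [intervalIntegral.intervalIntegral_eq_integral_uIoc]
    exact hi.integral_prod_right.smul (if (0 : ℝ) ≤ t then (1 : ℝ) else -1)
  · exact (intervalIntegral_integral_swap hi).symm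

end Expectation

section Dynkin

variable {p q α γ : ℝ} {Ω : Type*} [m : MeasurableSpace Ω] {P : Measure Ω}
  {ℱ : Filtration ℝ≥0 m} {X : ℝ≥0 → Ω → Config} {η : Config}

lemma IsASEP.measurable_uncurry (hX : IsASEP p q α γ P ℱ X η) :
    Measurable fun z : ℝ≥0 × Ω => X z.1 z.2 :=
  measurable_uncurry_of_rightContinuous X (fun t => (hX.adapted t).mono (ℱ.le t) le_rfl)
    hX.right_continuous

variable [IsProbabilityMeasure P]

/-- Dynkin's formula for local functions. -/
lemma IsASEP.expect_eq (hX : IsASEP p q α γ P ℱ X η) {f : Config → ℝ} (hf : IsLocal f)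
    (hfm : Measurable f) {C C' : ℝ} (hC : ∀ η, |f η| ≤ C)
    (hgm : Measurable (generator p q α γ f)) (hC' : ∀ η, |generator p q α γ f η| ≤ C') {t : ℝ}
    (ht : 0 ≤ t) :
    expect P X f t = f η + ∫ s in (0 : ℝ)..t, expect P X (generator p q α γ f) s := by
  have hm := hX.measurable_uncurry
  have hM := (hX.martingale f hf).setIntegral_eq (i := 0) (j := t.toNNReal) (zero_le)
    (s := Set.univ) MeasurableSet.univ
  obtain ⟨h1, h2⟩ := integral_intervalIntegral_process (P := P) hm hgm hC' t
  simp only [setIntegral_univ, NNReal.coe_zero, intervalIntegral.integral_same, sub_zero,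
    Real.coe_toNNReal t ht] at hM
  rw [integral_sub (integrable_comp (measurable_process hm) hfm hC _) h1, h2,
    integral_congr_ae (g := fun _ => f η)
      (hX.initial.mono fun ω h => by simp only [h])] at hM
  simp only [integral_const, probReal_univ, one_smul] at hM
  unfold expect at hM ⊢
  linarith

/-- The expected observables solve the free evolution equation on the Weyl chamber. -/
lemma IsASEP.expect_extH (hX : IsASEP p q α γ P ℱ X η) {r θ ρ : ℝ} (hp : 0 ≤ p) (hq : 0 ≤ q)
    (hr0 : 0 ≤ r) (hr1 : r < 1) (hθ0 : 0 ≤ θ) (hθ1 : θ ≤ 1) (hpr : p * r = q) (hα : α = p * ρ)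
    (hγ : γ = q * (1 - ρ)) (hθ : θ = ρ * r + 1 - ρ) {n : ℕ} (x : Fin (n + 1) → ℕ)
    (hx : x ∈ weyl (n + 1) 1) {t : ℝ} (ht : 0 ≤ t) :
    expect P X (fun ζ => extH r θ ζ x) t = extH r θ η x +
      ∫ s in (0 : ℝ)..t, freeOp p q (fun y => expect P X (fun ζ => extH r θ ζ y) s) x := by
  have hm := hX.measurable_uncurry
  set f : ℕ → Config → ℝ := fun k ζ => truncH r θ (k.succPNat + 1) ζ x with hf
  set g : ℕ → Config → ℝ := fun k ζ => freeOp p q (truncH r θ (k.succPNat + 1) ζ) x +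
    bondRate p q ζ k.succPNat * (truncH r θ (k.succPNat + 1) (exchange ζ k.succPNat) x -
      truncH r θ (k.succPNat + 1) ζ x) with hg
  -- Only eventually in `k`, because the truncation window must contain all coordinates of `x`.
  have hgen : ∀ᶠ k in atTop, generator p q α γ (f k) = g k := by
    have : ∀ᶠ k : ℕ in atTop, ∀ i, x i ≤ k := eventually_all.2 fun i => eventually_ge_atTop _
    filter_upwards [this] with k hk
    ext ζ
    exact generator_truncH p q r θ α γ ρ hpr hα hγ hθ _ ζ x hx fun i => by
      simp only [Nat.succPNat_coe]
      exact (hk i).trans k.le_succ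
  have hfm (k) : Measurable (f k) := measurable_truncH r θ _ x
  have hgm (k) : Measurable (g k) :=
    (measurable_freeOp p q x fun y => measurable_truncH r θ _ y).add
      ((measurable_bondRate p q _).mul
        (((measurable_truncH r θ _ x).comp (measurable_exchange _)).sub
          (measurable_truncH r θ _ x)))
  have hfC (k) (ζ) : |f k ζ| ≤ 1 := abs_truncH_le_one hr0 hr1.le hθ0 hθ1 ζ _ x
  have hgC (k) (ζ) : |g k ζ| ≤ (n + 1 : ℕ) * (2 * (p + q)) + (p + q) * 1 := by
    refine (abs_add_le _ _).trans (add_le_add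
      (abs_freeOp_le x hp hq fun y => abs_truncH_le_one hr0 hr1.le hθ0 hθ1 ζ _ y) ?_)
    rw [abs_mul]
    refine mul_le_mul (abs_bondRate_le hp hq _ _) ?_ (abs_nonneg _) (by positivity)
    have a (ζ) := truncH_nonneg hr0 hθ0 ζ (k.succPNat + 1) x
    have b (ζ) := truncH_le_one hr0 hr1.le hθ0 hθ1 ζ (k.succPNat + 1) x
    rw [abs_le]
    constructor <;> linarith [a ζ, b ζ, a (exchange ζ k.succPNat), b (exchange ζ k.succPNat)]
  have hsucc : Tendsto (fun k : ℕ => (k.succPNat : ℕ) + 1) atTop atTop :=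
    tendsto_add_atTop_nat 2
  have hflim (ζ) : Tendsto (fun k => f k ζ) atTop (𝓝 (extH r θ ζ x)) :=
    (tendsto_truncH θ ζ hr0 hr1 x).comp hsucc
  have hglim (ζ) : Tendsto (fun k => g k ζ) atTop (𝓝 (freeOp p q (extH r θ ζ) x)) := by
    have := (tendsto_freeOp p q x fun y => (tendsto_truncH θ ζ hr0 hr1 y).comp hsucc).add
      (tendsto_bondRate_mul_truncH_sub θ ζ hr0 hr1 p q hp hq hθ0 hθ1 x hx.2)
    rwa [add_zero] at this
  have hdyn : ∀ᶠ k in atTop,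
      f k η + ∫ s in (0 : ℝ)..t, expect P X (g k) s = expect P X (f k) t := by
    filter_upwards [hgen] with k hk
    rw [← hk]
    exact (hX.expect_eq (isLocal_truncH r θ _ x) (hfm k) (hfC k) (hk ▸ hgm k)
      (hk ▸ hgC k) ht).symm
  have l1 := tendsto_expect (P := P) (measurable_process hm) hfm
    (Eventually.of_forall hfC) hflim t
  have l2 := (hflim η).add
    (tendsto_integral_expect (P := P) hm hgm (Eventually.of_forall hgC) hglim t)
  rw [tendsto_nhds_unique l1 (l2.congr' hdyn)]
  congr 1
  refine intervalIntegral.integral_congr fun s _ => ?_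
  refine integral_freeOp p q x fun y => integrable_comp (C := 1) (measurable_process hm)
    (measurable_extH θ hr0 hr1 y) (fun ζ => ?_) _
  have := extH_mem_Icc θ ζ hr0 hr1 y hθ0 hθ1
  exact abs_le.2 ⟨by linarith [this.1], this.2⟩

end Dynkin

end HalfLineASEP

/-! ### Reduction of the free operator to the Weyl chamber, and uniqueness. -/

namespace HalfLineASEP

section Weyl

variable {n : ℕ}

lemma update_mem_weyl {x : Fin n → ℕ} (hx : x ∈ weyl n 1) {k : Fin n} {v : ℕ} (hv : 1 ≤ v)
    (hl : ∀ j < k, x j < v) (hr : ∀ j > k, v < x j) : Function.update x k v ∈ weyl n 1 := by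
  refine ⟨fun a b hab => ?_, fun i => ?_⟩
  · rw [Function.update_apply, Function.update_apply]
    split_ifs with h1 h2 h2
    · subst h1 h2; exact absurd hab (lt_irrefl _)
    · subst h1; exact hr _ hab
    · subst h2; exact hl _ hab
    · exact hx.1 hab
  · rw [Function.update_apply]
    split_ifs
    · exact hv
    · exact hx.2 i

variable {x : Fin (n + 1) → ℕ} (hx : x ∈ weyl (n + 1) 1)
include hx

lemma lower_zero_mem_weyl (h : x 0 ≠ 1) : lower x 0 ∈ weyl (n + 1) 1 := by
  have h0 := hx.2 0
  refine update_mem_weyl hx (by omega) (fun j hj => absurd hj (Fin.not_lt_zero j)) fun j hj => ?_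
  have := hx.1 hj
  omega

lemma raise_last_mem_weyl : raise x (Fin.last n) ∈ weyl (n + 1) 1 := by
  refine update_mem_weyl hx (by omega) (fun j hj => ?_) fun j hj =>
    absurd hj (Fin.le_last j).not_gt
  have := hx.1 hj
  omega

/-- Non-adjacency leaves a gap of at least two, so the move keeps the coordinates strictly ordered.
-/
lemma lower_succ_mem_weyl {i : Fin n} (h : x i.succ ≠ x i.castSucc + 1) :
    lower x i.succ ∈ weyl (n + 1) 1 := by
  have h0 := hx.2 i.castSucc
  have h1 := hx.1 i.castSucc_lt_succ
  refine update_mem_weyl hx (by omega) (fun j hj => ?_) fun j hj => ?_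
  · have := hx.1.monotone (Fin.le_castSucc_iff.2 hj)
    omega
  · have := hx.1 hj
    omega

lemma raise_castSucc_mem_weyl {i : Fin n} (h : x i.succ ≠ x i.castSucc + 1) :
    raise x i.castSucc ∈ weyl (n + 1) 1 := by
  have h1 := hx.1 i.castSucc_lt_succ
  refine update_mem_weyl hx (by omega) (fun j hj => ?_) fun j hj => ?_
  · have := hx.1 hj
    omega
  · have := hx.1.monotone (Fin.castSucc_lt_iff_succ_le.1 hj)
    omega

end Weyl

/-- The two-body and reservoir boundary conditions. -/
structure BoundaryConditions (p q θ : ℝ) {n : ℕ} (f : (Fin (n + 1) → ℕ) → ℝ) : Prop where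
  twoBody : ∀ x : Fin (n + 1) → ℕ, (∀ i, 1 ≤ x i) → ∀ i : Fin n,
    x i.succ = x i.castSucc + 1 →
      p * f (lower x i.succ) + q * f (raise x i.castSucc) = (p + q) * f x
  reservoir : ∀ y ∈ weyl n 2, f (Fin.cons 0 y) = θ * f (Fin.cons 1 y)

/-- The free operator reduced to the Weyl chamber by means of the boundary conditions. -/
noncomputable def weylOp (p q θ : ℝ) {n : ℕ} (f : (Fin (n + 1) → ℕ) → ℝ)
    (x : Fin (n + 1) → ℕ) : ℝ :=
  (if x 0 = 1 then p * (θ * f x) else p * f (lower x 0)) + q * f (raise x (Fin.last n))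
    + ∑ i : Fin n, (if x i.succ = x i.castSucc + 1 then (p + q) * f x
        else p * f (lower x i.succ) + q * f (raise x i.castSucc))
    - (n + 1) * ((p + q) * f x)

section WeylOp

variable {p q θ : ℝ} {n : ℕ} {f g : (Fin (n + 1) → ℕ) → ℝ} {x : Fin (n + 1) → ℕ}

/-- Pair the downward move of each coordinate with the upward move of its left neighbour: these two
leave the chamber together, exactly when the coordinates are adjacent, and then the two-body
relation replaces the pair. Unpaired are the upward move of the last coordinate, always allowed, and
the downward move of the first, for which the reservoir relation handles `x 0 = 1`. -/
lemma BoundaryConditions.freeOp_eq (hf : BoundaryConditions p q θ f) (hx : x ∈ weyl (n + 1) 1) :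
    freeOp p q f x = weylOp p q θ f x := by
  have h0 : p * f (lower x 0) = if x 0 = 1 then p * (θ * f x) else p * f (lower x 0) := by
    split_ifs with h
    · have hy : Fin.tail x ∈ weyl n 2 := by
        refine ⟨fun a b hab => hx.1 (Fin.succ_lt_succ_iff.2 hab), fun i => ?_⟩
        have := hx.1 (Fin.succ_pos i)
        show 2 ≤ x i.succ
        omega
      have e1 : lower x 0 = Fin.cons 0 (Fin.tail x) := by
        unfold lower
        rw [h, Nat.sub_self]
        conv_lhs => rw [← Fin.cons_self_tail x]
        rw [Fin.update_cons_zero]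
      have e2 : x = Fin.cons 1 (Fin.tail x) := by
        conv_lhs => rw [← Fin.cons_self_tail x, h]
      rw [e1, hf.reservoir _ hy, ← e2]
    · rfl
  have h1 (i : Fin n) : p * f (lower x i.succ) + q * f (raise x i.castSucc) =
      if x i.succ = x i.castSucc + 1 then (p + q) * f x
        else p * f (lower x i.succ) + q * f (raise x i.castSucc) := by
    split_ifs with h
    · exact hf.twoBody x hx.2 i h
    · rfl
  unfold freeOp weylOp
  rw [← h0, Finset.sum_sub_distrib, Finset.sum_add_distrib, Fin.sum_univ_succ,
    Fin.sum_univ_castSucc (fun i => q * f (raise x i)), ← Finset.sum_congr rfl fun i _ => h1 i,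
    Finset.sum_add_distrib]
  simp
  ring

lemma weylOp_sub (x : Fin (n + 1) → ℕ) :
    weylOp p q θ (fun y => f y - g y) x = weylOp p q θ f x - weylOp p q θ g x := by
  have (i : Fin n) : (if x i.succ = x i.castSucc + 1 then (p + q) * (f x - g x)
      else p * (f (lower x i.succ) - g (lower x i.succ)) +
        q * (f (raise x i.castSucc) - g (raise x i.castSucc))) =
      (if x i.succ = x i.castSucc + 1 then (p + q) * f x
        else p * f (lower x i.succ) + q * f (raise x i.castSucc)) -
      (if x i.succ = x i.castSucc + 1 then (p + q) * g x
        else p * g (lower x i.succ) + q * g (raise x i.castSucc)) := by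
    split_ifs <;> ring
  unfold weylOp
  rw [Finset.sum_congr rfl fun i _ => this i, Finset.sum_sub_distrib]
  split_ifs <;> ring

lemma continuous_weylOp {f : ℝ → (Fin (n + 1) → ℕ) → ℝ}
    (hf : ∀ y ∈ weyl (n + 1) 1, Continuous fun t => f t y) (hx : x ∈ weyl (n + 1) 1) :
    Continuous fun t => weylOp p q θ (f t) x := by
  refine ((Continuous.add (Continuous.add ?_ ?_) ?_).sub ?_)
  · split_ifs with h
    · exact ((hf x hx).const_mul θ).const_mul p
    · exact (hf _ (lower_zero_mem_weyl hx h)).const_mul p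
  · exact (hf _ (raise_last_mem_weyl hx)).const_mul q
  · refine continuous_finsetSum _ fun i _ => ?_
    split_ifs with h
    · exact (hf x hx).const_mul _
    · exact ((hf _ (lower_succ_mem_weyl hx h)).const_mul p).add
        ((hf _ (raise_castSucc_mem_weyl hx h)).const_mul q)
  · exact ((hf x hx).const_mul _).const_mul _

/-- The exponential weight. -/
noncomputable def expWeight (c : ℝ) {n : ℕ} (x : Fin n → ℕ) : ℝ := ∏ i, Real.exp (c * (x i : ℝ))

lemma expWeight_pos (c : ℝ) {n : ℕ} (x : Fin n → ℕ) : 0 < expWeight c x :=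
  Finset.prod_pos fun _ _ => Real.exp_pos _

lemma one_le_expWeight {c : ℝ} (hc : 0 ≤ c) {n : ℕ} (x : Fin n → ℕ) : 1 ≤ expWeight c x :=
  Finset.prod_induction _ (1 ≤ ·) (fun _ _ => one_le_mul_of_one_le_of_one_le) le_rfl
    fun _ _ => Real.one_le_exp (by positivity)

lemma expWeight_update_le {c : ℝ} (hc : 0 ≤ c) {n : ℕ} (x : Fin n → ℕ) (i : Fin n) {k : ℕ}
    (hk : k ≤ x i + 1) : expWeight c (Function.update x i k) ≤ Real.exp c * expWeight c x := by
  have h1 := prod_comp_update (fun k => Real.exp (c * (k : ℝ))) x i k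
  have h2 := prod_comp_update (fun k => Real.exp (c * (k : ℝ))) x i (x i)
  rw [Function.update_eq_self] at h2
  unfold expWeight
  rw [h1, h2, ← mul_assoc, ← Real.exp_add]
  have h3 : (k : ℝ) ≤ x i + 1 := by exact_mod_cast hk
  refine mul_le_mul_of_nonneg_right (Real.exp_le_exp.2 ?_)
    (Finset.prod_nonneg fun _ _ => (Real.exp_pos _).le)
  nlinarith

/-- The reduced operator is bounded on exponentially weighted functions. -/
lemma abs_weylOp_le (hp : 0 ≤ p) (hq : 0 ≤ q) (hθ0 : 0 ≤ θ) (hθ1 : θ ≤ 1) {c B : ℝ} (hc : 0 ≤ c)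
    (hB : 0 ≤ B) (hf : ∀ y ∈ weyl (n + 1) 1, |f y| ≤ B * expWeight c y)
    (hx : x ∈ weyl (n + 1) 1) :
    |weylOp p q θ f x| ≤ (2 * n + 2) * ((p + q) * Real.exp c) * (B * expWeight c x) := by
  set M := Real.exp c * (B * expWeight c x) with hM
  have hE := expWeight_pos c x
  have hupd (i k) (hk : k ≤ x i + 1) (hm : Function.update x i k ∈ weyl (n + 1) 1) :
      |f (Function.update x i k)| ≤ M := by
    refine (hf _ hm).trans ?_
    rw [hM, mul_left_comm]
    exact mul_le_mul_of_nonneg_left (expWeight_update_le hc x i hk) hB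
  have hself : |f x| ≤ M := by
    refine (hf x hx).trans (le_mul_of_one_le_left (by positivity) (Real.one_le_exp hc))
  have hmul {a b : ℝ} (ha : 0 ≤ a) (hb : |b| ≤ M) : |a * b| ≤ a * M := by
    rw [abs_mul, abs_of_nonneg ha]
    exact mul_le_mul_of_nonneg_left hb ha
  have b1 : |if x 0 = 1 then p * (θ * f x) else p * f (lower x 0)| ≤ p * M := by
    split_ifs with h
    · refine hmul hp ((hmul hθ0 hself).trans (mul_le_of_le_one_left (by positivity) hθ1))
    · exact hmul hp (hupd _ _ (by omega) (lower_zero_mem_weyl hx h))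
  have b2 : |q * f (raise x (Fin.last n))| ≤ q * M :=
    hmul hq (hupd _ _ le_rfl (raise_last_mem_weyl hx))
  have b3 : |∑ i : Fin n, (if x i.succ = x i.castSucc + 1 then (p + q) * f x
        else p * f (lower x i.succ) + q * f (raise x i.castSucc))| ≤ n * ((p + q) * M) := by
    refine (Finset.abs_sum_le_sum_abs _ _).trans ?_
    refine (Finset.sum_le_card_nsmul _ _ ((p + q) * M) fun i _ => ?_).trans (by simp)
    split_ifs with h
    · exact hmul (by positivity) hself
    · rw [add_mul]
      exact (abs_add_le _ _).trans (add_le_add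
        (hmul hp (hupd _ _ (by omega) (lower_succ_mem_weyl hx h)))
        (hmul hq (hupd _ _ le_rfl (raise_castSucc_mem_weyl hx h))))
  have b4 : |((n : ℝ) + 1) * ((p + q) * f x)| ≤ (n + 1) * ((p + q) * M) := by
    rw [abs_mul, abs_of_nonneg (show (0 : ℝ) ≤ n + 1 by positivity)]
    exact mul_le_mul_of_nonneg_left (hmul (by positivity) hself) (by positivity)
  calc |weylOp p q θ f x| ≤ p * M + q * M + n * ((p + q) * M) + (n + 1) * ((p + q) * M) :=
        (abs_sub _ _).trans (add_le_add ((abs_add_le _ _).trans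
          (add_le_add ((abs_add_le _ _).trans (add_le_add b1 b2)) b3)) b4)
    _ = _ := by rw [hM]; ring

/-- Uniqueness of the reduced evolution equation among functions of exponential growth. -/
lemma eq_zero_of_weylOp (hp : 0 ≤ p) (hq : 0 ≤ q) (hθ0 : 0 ≤ θ) (hθ1 : θ ≤ 1) {c C T : ℝ}
    (hc : 0 ≤ c) (hC : 0 ≤ C) (w : ℝ → (Fin (n + 1) → ℕ) → ℝ)
    (hw : ∀ x ∈ weyl (n + 1) 1, ∀ t ∈ Set.Icc 0 T,
      HasDerivWithinAt (fun s => w s x) (weylOp p q θ (w t) x) (Set.Ici 0) t)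
    (hw0 : ∀ x ∈ weyl (n + 1) 1, w 0 x = 0)
    (hbound : ∀ t ∈ Set.Icc 0 T, ∀ x ∈ weyl (n + 1) 1, |w t x| ≤ C * expWeight c x) :
    ∀ t ∈ Set.Icc 0 T, ∀ x ∈ weyl (n + 1) 1, w t x = 0 := by
  set K := (2 * n + 2) * ((p + q) * Real.exp c) with hK
  have hK0 : 0 ≤ K := by positivity
  -- Picard iteration: the bound of order `k`, inserted in the equation, bounds the time derivative
  -- by `K` times itself, and integration from the zero initial value gives order `k + 1`. The
  -- constant `K` is the operator bound of `abs_weylOp_le`.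
  have key (k : ℕ) : ∀ t ∈ Set.Icc 0 T, ∀ x ∈ weyl (n + 1) 1,
      |w t x| ≤ C * ((K * t) ^ k / k.factorial) * expWeight c x := by
    induction k with
    | zero => simpa using hbound
    | succ k ih =>
      intro t ht x hx
      refine image_norm_le_of_norm_deriv_right_le_deriv_boundary (f := fun s => w s x)
        (f' := fun s => weylOp p q θ (w s) x)
        (B := fun s => C * ((K * s) ^ (k + 1) / (k + 1).factorial) * expWeight c x)
        (B' := fun s => K * (C * ((K * s) ^ k / k.factorial) * expWeight c x))
        (fun s hs => ((hw x hx s hs).mono Set.Icc_subset_Ici_self).continuousWithinAt)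
        (fun s hs => (hw x hx s (Set.Ico_subset_Icc_self hs)).mono (Set.Ici_subset_Ici.2 hs.1))
        ?_ (fun s => ?_) (fun s hs => ?_) ht
      · simp [hw0 x hx]
      · have h1 := (((((hasDerivAt_id s).const_mul K).pow (k + 1)).div_const
          ((k + 1).factorial : ℝ)).const_mul C).mul_const (expWeight c x)
        refine h1.congr_deriv ?_
        rw [Nat.factorial_succ]
        have := Nat.factorial_pos k
        push_cast
        simp only [id]
        field_simp
      · have hs0 := hs.1
        exact abs_weylOp_le hp hq hθ0 hθ1 hc (by positivity)
          (fun y hy => ih s (Set.Ico_subset_Icc_self hs) y hy) hx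
  intro t ht x hx
  have hlim : Tendsto (fun k : ℕ => C * ((K * t) ^ k / k.factorial) * expWeight c x) atTop
      (𝓝 0) := by
    have := ((FloorSemiring.tendsto_pow_div_factorial_atTop (K * t)).const_mul C).mul_const
      (expWeight c x)
    rwa [mul_zero, zero_mul] at this
  exact abs_nonpos_iff.1 (ge_of_tendsto' hlim fun k => key k t ht x hx)

end WeylOp

/-! ### Boundary relations of the observables and of their expectations. -/

section Extended

variable {r : ℝ} (θ : ℝ) (η : Config) (hr0 : 0 ≤ r) (hr1 : r < 1)

lemma extH_of_mem_weyl {n : ℕ} {x : Fin n → ℕ} (hx : ∀ i, 1 ≤ x i) :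
    extH r θ η x = H r η x :=
  Finset.prod_congr rfl fun i _ => if_neg (Nat.one_le_iff_ne_zero.1 (hx i))

include hr0 hr1

lemma extQ_eq_mul (x : ℕ) : extQ r θ x η = siteWeight r θ η x * extQ r θ (x + 1) η := by
  refine tendsto_nhds_unique (tendsto_truncQ θ η hr0 hr1 x)
    (((tendsto_truncQ θ η hr0 hr1 (x + 1)).const_mul _).congr' ?_)
  filter_upwards [eventually_gt_atTop x] with L hL
  exact (truncQ_eq_mul _ _ _ hL).symm

/-- With `s ∈ {1, r}` the weight of site `x i.castSucc`, the two-body relation becomes `p s ^ 2 + q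
= (p + q) s`, which has exactly these roots when `p * r = q`. The reservoir relation is built into
`extQ` at `0`. -/
lemma boundaryConditions_extH (p q : ℝ) (hpr : p * r = q) (n : ℕ) :
    BoundaryConditions p q θ (n := n) (extH r θ η) := by
  refine ⟨fun x hx i hi => ?_, fun y _ => ?_⟩
  · have hne : i.castSucc ≠ i.succ := i.castSucc_lt_succ.ne
    have e1 := prod_comp_update (fun k => extQ r θ k η) x i.succ (x i.succ - 1)
    have e2 := prod_comp_update (fun k => extQ r θ k η) x i.castSucc (x i.castSucc + 1)
    have e3 := prod_comp_update (fun k => extQ r θ k η) x i.succ (x i.succ)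
    rw [← Finset.mul_prod_erase _ _ (Finset.mem_erase.2 ⟨hne, Finset.mem_univ _⟩)] at e1 e3
    rw [← Finset.mul_prod_erase _ _ (Finset.mem_erase.2 ⟨hne.symm, Finset.mem_univ _⟩),
      Finset.erase_right_comm] at e2
    rw [Function.update_eq_self] at e3
    unfold extH lower raise
    rw [e1, e2, e3, hi, Nat.add_sub_cancel, extQ_eq_mul θ η hr0 hr1 (x i.castSucc)]
    subst hpr
    have h0 : x i.castSucc ≠ 0 := Nat.one_le_iff_ne_zero.1 (hx _)
    rw [siteWeight, if_neg h0]
    split_ifs <;> ring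
  · unfold extH
    rw [Fin.prod_univ_succ, Fin.prod_univ_succ]
    simp only [Fin.cons_zero, Fin.cons_succ, extQ, if_true, one_ne_zero, if_false]
    ring

end Extended

section Duality

variable {p q α γ : ℝ} {Ω : Type*} [m : MeasurableSpace Ω] {P : Measure Ω}
  {ℱ : Filtration ℝ≥0 m} {X : ℝ≥0 → Ω → Config} {η : Config}

lemma expect_max_zero (F : Config → ℝ) (t : ℝ) : expect P X F (max t 0) = expect P X F t := by
  unfold expect
  rw [← Real.coe_toNNReal', Real.toNNReal_coe]

variable [IsProbabilityMeasure P]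

lemma IsASEP.boundaryConditions_expect (hX : IsASEP p q α γ P ℱ X η) {r θ : ℝ}
    (hr0 : 0 ≤ r) (hr1 : r < 1) (hθ0 : 0 ≤ θ) (hθ1 : θ ≤ 1) (hpr : p * r = q) (n : ℕ) (t : ℝ) :
    BoundaryConditions p q θ (n := n) fun y => expect P X (fun ζ => extH r θ ζ y) t := by
  have hi (y : Fin (n + 1) → ℕ) : Integrable (fun ω => extH r θ (X t.toNNReal ω) y) P :=
    integrable_comp (C := 1) (measurable_process hX.measurable_uncurry)
      (measurable_extH θ hr0 hr1 y) (fun ζ => by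
        have := extH_mem_Icc θ ζ hr0 hr1 y hθ0 hθ1
        exact abs_le.2 ⟨by linarith [this.1], this.2⟩) _
  have hb (ζ : Config) := boundaryConditions_extH θ ζ hr0 hr1 p q hpr n
  refine ⟨fun x hx i h => ?_, fun y hy => ?_⟩
  · simp only [expect]
    rw [← integral_const_mul, ← integral_const_mul, ← integral_const_mul,
      ← integral_add ((hi _).const_mul p) ((hi _).const_mul q)]
    exact integral_congr_ae (Eventually.of_forall fun ω => (hb _).twoBody x hx i h)
  · simp only [expect]
    rw [← integral_const_mul]
    exact integral_congr_ae (Eventually.of_forall fun ω => (hb _).reservoir y hy)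

/-- The expected observables are differentiable in time and solve the reduced evolution
equation. -/
lemma IsASEP.hasDerivWithinAt_expect (hX : IsASEP p q α γ P ℱ X η) {r θ ρ : ℝ} (hp : 0 ≤ p)
    (hq : 0 ≤ q) (hr0 : 0 ≤ r) (hr1 : r < 1) (hθ0 : 0 ≤ θ) (hθ1 : θ ≤ 1) (hpr : p * r = q)
    (hα : α = p * ρ) (hγ : γ = q * (1 - ρ)) (hθ : θ = ρ * r + 1 - ρ) {n : ℕ}
    (x : Fin (n + 1) → ℕ) (hx : x ∈ weyl (n + 1) 1) {t : ℝ} (ht : 0 ≤ t) :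
    HasDerivWithinAt (expect P X fun ζ => extH r θ ζ x)
      (weylOp p q θ (fun y => expect P X (fun ζ => extH r θ ζ y) t) x) (Set.Ici 0) t := by
  have hm := hX.measurable_uncurry
  set v : ℝ → (Fin (n + 1) → ℕ) → ℝ := fun s y => expect P X (fun ζ => extH r θ ζ y) s with hv
  have hC (y : Fin (n + 1) → ℕ) (ζ) : |extH r θ ζ y| ≤ 1 := by
    have := extH_mem_Icc θ ζ hr0 hr1 y hθ0 hθ1
    exact abs_le.2 ⟨by linarith [this.1], this.2⟩
  have hvm (y) : Measurable fun s => v s y :=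
    measurable_expect hm (measurable_extH θ hr0 hr1 y)
  have hint (y : Fin (n + 1) → ℕ) (a b : ℝ) :
      IntervalIntegrable (fun s => freeOp p q (v s) y) volume a b :=
    (intervalIntegrable_const (c := ((n + 1 : ℕ) : ℝ) * (2 * (p + q)))).mono_fun
      (measurable_freeOp p q y hvm).aestronglyMeasurable (Eventually.of_forall fun s => by
        simp only [Real.norm_eq_abs]
        exact (abs_freeOp_le y hp hq fun z => abs_expect_le (hC z) s).trans (le_abs_self _))
  -- The integral equation holds for nonnegative times only; since `toNNReal` sends negative times
  -- to `0`, replacing `s` by `max s 0` extends it to the whole line.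
  have hcont (y) (hy : y ∈ weyl (n + 1) 1) : Continuous fun s => v s y := by
    have e : (fun s => v s y) = fun s => extH r θ η y +
        ∫ z in (0 : ℝ)..max s 0, freeOp p q (v z) y := by
      ext s
      rw [← hX.expect_extH hp hq hr0 hr1 hθ0 hθ1 hpr hα hγ hθ y hy (le_max_right s 0),
        expect_max_zero]
    rw [e]
    exact continuous_const.add ((intervalIntegral.continuous_primitive (hint y) 0).comp
      (continuous_id.max continuous_const))
  -- Continuity is known at chamber points only, and the reduced operator uses no others; its
  -- integrand is therefore continuous and the integral equation can be differentiated.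
  have heq (s) : freeOp p q (v s) x = weylOp p q θ (v s) x :=
    (hX.boundaryConditions_expect hr0 hr1 hθ0 hθ1 hpr n s).freeOp_eq hx
  have hd := ((continuous_weylOp (p := p) (q := q) (θ := θ) hcont hx).integral_hasStrictDerivAt
    0 t).hasDerivAt.const_add (extH r θ η x)
  refine hd.hasDerivWithinAt.congr_of_mem (fun s hs => ?_) ht
  rw [hX.expect_extH hp hq hr0 hr1 hθ0 hθ1 hpr hα hγ hθ x hx hs]
  exact congrArg _ (intervalIntegral.integral_congr fun z _ => heq z)

end Duality

end HalfLineASEP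

open HalfLineASEP in
theorem proposition2p8
    -- rates, with `0 < q / p < 1`, and Liggett's condition; `ρ` is the boundary density
    (p q α γ ρ : ℝ) (hq : 0 < q) (hqp : q < p) (hα : 0 ≤ α) (hγ : 0 ≤ γ)
    (hLiggett : α / p + γ / q = 1) (hρ : ρ = α / p)
    -- an initial configuration with finitely many particles, and the process started from it
    (η : Config) (hη : {x : ℕ+ | η x = true}.Finite)
    {Ω : Type*} [m : MeasurableSpace Ω] (P : Measure Ω) [IsProbabilityMeasure P]
    (ℱ : Filtration ℝ≥0 m) (X : ℝ≥0 → Ω → Config) (hX : IsASEP p q α γ P ℱ X η)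
    -- there are `n + 1 ≥ 1` space variables
    (n : ℕ) (u : ℝ → (Fin (n + 1) → ℕ) → ℝ)
    (h_evolution : ∀ x : Fin (n + 1) → ℕ, (∀ i, 1 ≤ x i) → ∀ t : ℝ, 0 ≤ t →
      HasDerivWithinAt (fun s => u s x) (freeOp p q (u t) x) (Set.Ici 0) t)
    (h_twoBody : ∀ t : ℝ, 0 ≤ t → ∀ x : Fin (n + 1) → ℕ, (∀ i, 1 ≤ x i) → ∀ i : Fin n,
      x i.succ = x i.castSucc + 1 →
        p * u t (lower x i.succ) + q * u t (raise x i.castSucc) = (p + q) * u t x)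
    (h_boundary : ∀ t : ℝ, 0 ≤ t → ∀ y ∈ weyl n 2,
      u t (Fin.cons 0 y) = (ρ * (q / p) + 1 - ρ) * u t (Fin.cons 1 y))
    (h_growth : ∀ T : ℝ, 0 < T → ∃ c C : ℝ, 0 < c ∧ 0 < C ∧
      ∀ t ∈ Set.Icc 0 T, ∀ x ∈ weyl (n + 1) 1, |u t x| ≤ C * ∏ i, Real.exp (c * (x i : ℝ)))
    (h_initial : ∀ x ∈ weyl (n + 1) 1, u 0 x = H (q / p) η x) :
    ∀ x ∈ weyl (n + 1) 1, ∀ t : ℝ≥0,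
      Integrable (fun ω => H (q / p) (X t ω) x) P ∧
        u t x = ∫ ω, H (q / p) (X t ω) x ∂P := by
  have hp : 0 < p := hq.trans hqp
  set r := q / p with hr
  have hr0 : 0 ≤ r := (div_pos hq hp).le
  have hr1 : r < 1 := (div_lt_one hp).2 hqp
  have hpr : p * r = q := mul_div_cancel₀ q hp.ne'
  have hα' : α = p * ρ := by rw [hρ, mul_div_cancel₀ α hp.ne']
  have hγ1 : γ / q = 1 - ρ := by rw [hρ]; linarith
  have hγ' : γ = q * (1 - ρ) := by rw [← hγ1, mul_div_cancel₀ γ hq.ne']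
  have hρ0 : 0 ≤ ρ := hρ ▸ div_nonneg hα hp.le
  have hρ1 : 0 ≤ 1 - ρ := hγ1 ▸ div_nonneg hγ hq.le
  set θ := ρ * r + 1 - ρ with hθ
  -- Since `0 ≤ ρ ≤ 1`, `θ` is a convex combination of `r` and `1`.
  have hθ0 : 0 ≤ θ := by nlinarith [mul_nonneg hρ0 hr0]
  have hθ1 : θ ≤ 1 := by nlinarith
  have hC (y : Fin (n + 1) → ℕ) (ζ) : |extH r θ ζ y| ≤ 1 := by
    have := extH_mem_Icc θ ζ hr0 hr1 y hθ0 hθ1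
    exact abs_le.2 ⟨by linarith [this.1], this.2⟩
  intro x hx t
  have hH (ω) : H r (X t ω) x = extH r θ (X t ω) x := (extH_of_mem_weyl θ _ hx.2).symm
  simp only [hH]
  refine ⟨integrable_comp (measurable_process hX.measurable_uncurry)
    (measurable_extH θ hr0 hr1 x) (hC x) t, ?_⟩
  -- The horizon `t + 1` is positive even when `t = 0`.
  obtain ⟨c, C, hc, hC0, hgrowth⟩ := h_growth (t + 1) (by positivity)
  have hu (s : ℝ) (hs : 0 ≤ s) : BoundaryConditions p q θ (u s) :=
    ⟨h_twoBody s hs, h_boundary s hs⟩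
  -- The difference is bounded by `C + 1` times the weight: `C` comes from the growth of `u`, and
  -- `1` from the expectation, which is at most `1` while the weight is at least `1`.
  have key := eq_zero_of_weylOp (T := t + 1) hp.le hq.le hθ0 hθ1 hc.le
    (add_nonneg hC0.le zero_le_one)
    (fun s y => u s y - expect P X (fun ζ => extH r θ ζ y) s) (fun y hy s hs => ?_)
    (fun y hy => ?_) (fun s hs y hy => ?_) t ⟨t.2, by linarith⟩ x hx
  · rw [sub_eq_zero] at key
    rw [key, expect, Real.toNNReal_coe]
  · rw [weylOp_sub, ← (hu s hs.1).freeOp_eq hy]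
    exact (h_evolution y hy.2 s hs.1).sub (hX.hasDerivWithinAt_expect hp.le hq.le hr0 hr1 hθ0 hθ1
      hpr hα' hγ' hθ y hy hs.1)
  · rw [h_initial y hy, ← extH_of_mem_weyl θ η hy.2, sub_eq_zero,
      hX.expect_extH hp.le hq.le hr0 hr1 hθ0 hθ1 hpr hα' hγ' hθ y hy le_rfl,
      intervalIntegral.integral_same, add_zero]
  · rw [add_mul, one_mul]
    exact (abs_sub _ _).trans (add_le_add (hgrowth s hs y hy)
      ((abs_expect_le (hC y) s).trans (one_le_expWeight hc.le y)))
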